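/- All local rings are Noetherian and all modules are finitely generated. A local ring $R$ is Cohen–Macaulay (CM) if $\operatorname{depth} R=\dim R$, and an $R$-module $M$ over a CM local ring is called CM (that is, maximal Cohen–Macaulay) if $M=0$ or $\operatorname{depth}_R M=\dim R$. Let $\Omega\mathrm{CM}^{\times}(R)$ be the class of CM $R$-modules $M$ that are isomorphic to the kernel of an epimorphism from a finitely generated free $R$-module to a CM $R$-module and that have no nonzero free direct summand. Let $R\to S$ be a faithfully flat homomorphism of CM local rings and let $M$ be a CM $R$-module. Then $M\in\Omega\mathrm{CM}^{\times}(R)$ if and only if $M\otimes_R S\in\Omega\mathrm{CM}^{\times}(S)$. -/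

import Mathlib

universe u

/-- The depth of a module `M` over a local ring `R`: the supremum of the lengths of the `M`-regular
sequences of elements of the maximal ideal (so the zero module, which has no regular sequence at
all, gets the value `0` here; it is treated separately below). -/
noncomputable def localDepth (R : Type*) [CommRing R] [IsLocalRing R]
    (M : Type*) [AddCommGroup M] [Module R M] : ℕ∞ :=
  ⨆ rs : {rs : List R // (∀ r ∈ rs, r ∈ IsLocalRing.maximalIdeal R) ∧
    RingTheory.Sequence.IsRegular M rs}, (rs.1.length : ℕ∞)

/-- A Cohen-Macaulay local ring: a Noetherian local ring whose depth equals its Krull dimension. -/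
class IsCMLocalRing (R : Type*) [CommRing R] : Prop extends IsLocalRing R, IsNoetherianRing R where
  depth_eq_dim : ((localDepth R R : ℕ∞) : WithBot ℕ∞) = ringKrullDim R

/-- A finitely generated module over a local ring `R` is (maximal) Cohen-Macaulay if it is zero or
its depth equals the Krull dimension of `R`. -/
def IsMCM (R : Type*) [CommRing R] [IsLocalRing R]
    (M : Type*) [AddCommGroup M] [Module R M] : Prop :=
  Module.Finite R M ∧
    (Subsingleton M ∨ ((localDepth R M : ℕ∞) : WithBot ℕ∞) = ringKrullDim R)

/-- Membership in `ΩCM(R)`: `M` is Cohen-Macaulay and is isomorphic to the kernel of an epimorphism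
from a finitely generated free module to a Cohen-Macaulay module. -/
def IsSyzygyOfMCM (R : Type u) [CommRing R] [IsLocalRing R]
    (M : Type*) [AddCommGroup M] [Module R M] : Prop :=
  IsMCM R M ∧
    ∃ (n : ℕ) (N : Type u) (_ : AddCommGroup N) (_ : Module R N) (p : (Fin n → R) →ₗ[R] N),
      IsMCM R N ∧ Function.Surjective p ∧ Nonempty (M ≃ₗ[R] LinearMap.ker p)

/-- `M` has a nonzero free direct summand. -/
def HasNonzeroFreeSummand (R : Type*) [CommRing R]
    (M : Type*) [AddCommGroup M] [Module R M] : Prop :=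
  ∃ P Q : Submodule R M, IsCompl P Q ∧ P ≠ ⊥ ∧ Module.Free R P

/-- Membership in `ΩCM^×(R)`: `M` is in `ΩCM(R)` and has no nonzero free direct summand. -/
def IsOCMS (R : Type*) [CommRing R] [IsLocalRing R]
    (M : Type*) [AddCommGroup M] [Module R M] : Prop :=
  IsSyzygyOfMCM R M ∧ ¬ HasNonzeroFreeSummand R M

open IsLocalRing RingTheory.Sequence Pointwise

/-! Generators of the dual of `M` give a map `f : M → Rⁿ` through which every functional factors. A
CM module `M` lies in ΩCM iff `f` is injective with CM cokernel (`isSyzygyOfMCM_iff`): given 0 → M →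
Rᵏ → N → 0, a pushout yields 0 → Rⁿ → coker f ⊕ Rᵏ → N → 0, so coker f is a summand of a CM module.
Since Hom commutes with flat base change, `S ⊗ f` is again such a map, and injectivity and cokernels
are compatible with S.

It remains to see that CM modules ascend and descend (`isMCM_baseChange_iff`). This needs only part
of the depth formula for flat local maps. Dividing out a maximal regular sequence leaves a module K
containing the residue field k; an element regular on S ⊗ K is regular on S ⊗ k, hence on S ⊗ N for
every finite N, and the quotient of S by it is still flat over R. Thus depth bounds pass from S ⊗ K
to all S ⊗ N.

A free summand is a functional with a unit value, and this too is insensitive to base change. -/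

/-- There is a weakly `M`-regular sequence of length `n` in the maximal ideal. For nonzero finitely
generated modules this says that the depth is at least `n`; the zero module has it for all `n`. -/
def DepthGE (R : Type*) [CommRing R] [IsLocalRing R] (M : Type*) [AddCommGroup M] [Module R M]
    (n : ℕ) : Prop :=
  ∃ rs : List R, rs.length = n ∧ (∀ r ∈ rs, r ∈ maximalIdeal R) ∧ IsWeaklyRegular M rs

namespace DepthGE

/-! ### Depth bounds by regular sequences -/

section Basic

variable {R : Type*} [CommRing R] [IsLocalRing R] {M : Type*} [AddCommGroup M] [Module R M]
  {N : Type*} [AddCommGroup N] [Module R N]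

lemma zero : DepthGE R M 0 := ⟨[], rfl, by simp, IsWeaklyRegular.nil R M⟩

lemma succ_iff {n : ℕ} : DepthGE R M (n + 1) ↔
    ∃ x ∈ maximalIdeal R, IsSMulRegular M x ∧ DepthGE R (QuotSMulTop x M) n := by
  constructor
  · rintro ⟨_ | ⟨x, rs⟩, hl, hm, hr⟩
    · simp at hl
    · rw [isWeaklyRegular_cons_iff] at hr
      exact ⟨x, hm x (by simp), hr.1, rs, by simpa using hl,
        fun r h => hm r (List.mem_cons_of_mem _ h), hr.2⟩
  · rintro ⟨x, hx, hr, rs, hl, hm, hrs⟩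
    exact ⟨x :: rs, by simp [hl], by simpa only [List.forall_mem_cons] using ⟨hx, hm⟩, .cons hr hrs⟩

lemma congr (e : M ≃ₗ[R] N) {n : ℕ} (h : DepthGE R M n) : DepthGE R N n := by
  obtain ⟨rs, hl, hm, hr⟩ := h
  exact ⟨rs, hl, hm, (e.isWeaklyRegular_congr rs).1 hr⟩

lemma mono {m n : ℕ} (hmn : m ≤ n) (h : DepthGE R M n) : DepthGE R M m := by
  obtain ⟨rs, hl, hm, hr⟩ := h
  refine ⟨rs.take m, by simp [hl, hmn], fun r hr => hm r (List.mem_of_mem_take hr), ?_⟩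
  rw [← List.take_append_drop m rs, isWeaklyRegular_append_iff] at hr
  exact hr.1

lemma one_iff : DepthGE R M 1 ↔ ∃ x ∈ maximalIdeal R, IsSMulRegular M x := by
  rw [succ_iff]
  exact ⟨fun ⟨x, h, h', _⟩ => ⟨x, h, h'⟩, fun ⟨x, h, h'⟩ => ⟨x, h, h', zero⟩⟩

/-- Depth does not drop on passing to a direct summand. -/
lemma of_retract {n : ℕ} (i : N →ₗ[R] M) (p : M →ₗ[R] N) (hpi : p ∘ₗ i = LinearMap.id)
    (h : DepthGE R M n) : DepthGE R N n := by
  induction n generalizing M N with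
  | zero => exact zero
  | succ n ih =>
    obtain ⟨x, hx, hr, hd⟩ := succ_iff.1 h
    refine succ_iff.2 ⟨x, hx, hr.of_injective i ?_, ih (QuotSMulTop.map x i)
      (QuotSMulTop.map x p) ?_ hd⟩
    · exact Function.LeftInverse.injective (g := p) (fun v => LinearMap.congr_fun hpi v)
    · rw [← QuotSMulTop.map_comp, hpi, QuotSMulTop.map_id]

/-- Two quotients in succession commute. -/
lemma quot_comm {x y : R} {n : ℕ} (h : DepthGE R (QuotSMulTop x (QuotSMulTop y M)) n) :
    DepthGE R (QuotSMulTop y (QuotSMulTop x M)) n :=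
  h.congr <| QuotSMulTop.equivQuotTensor x _ ≪≫ₗ (QuotSMulTop.equivQuotTensor y M).lTensor _ ≪≫ₗ
    TensorProduct.leftComm R _ _ _ ≪≫ₗ (QuotSMulTop.equivQuotTensor x M).symm.lTensor _ ≪≫ₗ
    (QuotSMulTop.equivQuotTensor y _).symm

end Basic

section Noetherian

variable {R : Type*} [CommRing R] [IsLocalRing R] [IsNoetherianRing R]
  {M : Type*} [AddCommGroup M] [Module R M] [Module.Finite R M]
  {N : Type*} [AddCommGroup N] [Module R N] [Module.Finite R N]

/-- Positive depth means trivial socle. -/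
lemma one_iff_socle :
    DepthGE R M 1 ↔ ∀ v : M, (∀ r ∈ maximalIdeal R, r • v = 0) → v = 0 := by
  rw [one_iff]
  constructor
  · rintro ⟨x, hx, hr⟩ v hv
    exact hr.right_eq_zero_of_smul (hv x hx)
  · intro h
    have : Subsingleton ((R ⧸ maximalIdeal R) →ₗ[R] M) := by
      refine subsingleton_of_forall_eq 0 fun f => ?_
      refine Submodule.linearMap_qext _ (LinearMap.ext_ring ?_)
      refine h _ fun r hr => ?_
      rw [← map_smul, LinearMap.comp_apply]
      have : (maximalIdeal R).mkQ (r • 1) = 0 := by simpa using Ideal.Quotient.eq_zero_iff_mem.2 hr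
      rw [this, map_zero]
    obtain ⟨x, hx, hr⟩ := IsSMulRegular.subsingleton_linearMap_iff.1 this
    rw [Ideal.annihilator_quotient] at hx
    exact ⟨x, hx, hr⟩

lemma prod_one (hM : DepthGE R M 1) (hN : DepthGE R N 1) : DepthGE R (M × N) 1 := by
  rw [one_iff_socle] at *
  intro v hv
  exact Prod.ext (hM _ fun r hr => congrArg Prod.fst (hv r hr))
    (hN _ fun r hr => congrArg Prod.snd (hv r hr))

/-- Trivial socle passes to products, so a regular element on `M × N` serves both factors. -/
lemma exists_regular_prod (hM : DepthGE R M 1) (hN : DepthGE R N 1) :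
    ∃ x ∈ maximalIdeal R, IsSMulRegular M x ∧ IsSMulRegular N x := by
  obtain ⟨x, hx, hr⟩ := one_iff.1 (prod_one hM hN)
  exact ⟨x, hx, hr.of_injective (LinearMap.inl R M N) LinearMap.inl_injective,
    hr.of_injective (LinearMap.inr R M N) LinearMap.inr_injective⟩

omit [IsNoetherianRing R] [IsLocalRing R] [Module.Finite R M] in
/-- Exchange: an element of the socle of `M/xM` gives one of `M/yM`. -/
lemma exists_exchange {x y : R} (hx : IsSMulRegular M x) (hy : IsSMulRegular M y) {I : Ideal R}
    (hyI : y ∈ I) (h : ∀ v : QuotSMulTop y M, (∀ r ∈ I, r • v = 0) → v = 0) (v : QuotSMulTop x M)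
    (hv : ∀ r ∈ I, r • v = 0) : v = 0 := by
  obtain ⟨m, rfl⟩ := Submodule.mkQ_surjective _ v
  have key : ∀ r ∈ I, ∃ w, x • w = r • m := fun r hr => by
    have := hv r hr
    rw [← map_smul, Submodule.mkQ_apply, Submodule.Quotient.mk_eq_zero,
      Submodule.mem_smul_pointwise_iff_exists] at this
    obtain ⟨w, -, hw⟩ := this
    exact ⟨w, hw⟩
  -- With y m = x w, the class of w in M/yM is killed by I, so w = y u and then m = x u.
  obtain ⟨w, hw⟩ := key y hyI
  have := h (Submodule.Quotient.mk w) fun r hr => by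
    obtain ⟨u, hu⟩ := key r hr
    rw [← Submodule.Quotient.mk_smul, Submodule.Quotient.mk_eq_zero,
      Submodule.mem_smul_pointwise_iff_exists]
    refine ⟨u, trivial, hx ?_⟩
    change x • y • u = x • r • w
    rw [smul_comm x y, hu, smul_comm x r, hw, smul_comm]
  rw [Submodule.Quotient.mk_eq_zero, Submodule.mem_smul_pointwise_iff_exists] at this
  obtain ⟨u, -, rfl⟩ := this
  rw [Submodule.mkQ_apply, Submodule.Quotient.mk_eq_zero,
    Submodule.mem_smul_pointwise_iff_exists]
  refine ⟨u, trivial, hy ?_⟩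
  change y • x • u = y • m
  rw [← hw, smul_comm]

/-- Dividing by a regular element drops the depth by at most one. -/
theorem quotSMulTop {n : ℕ} (h : DepthGE R M (n + 1)) {x : R} (hx : x ∈ maximalIdeal R)
    (hr : IsSMulRegular M x) : DepthGE R (QuotSMulTop x M) n := by
  induction n generalizing M x with
  | zero => exact zero
  | succ n ih =>
    obtain ⟨y, hy, hyr, hd⟩ := succ_iff.1 h
    have h1 : DepthGE R (QuotSMulTop y M) 1 := hd.mono (by omega)
    have h2 : DepthGE R (QuotSMulTop x M) 1 :=
      one_iff_socle.2 (exists_exchange hr hyr hy (one_iff_socle.1 h1))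
    -- The element z links x to y: depth passes from M/yM to M/(y, z), then up to M/zM, down to
    -- M/(z, x), and up to M/xM.
    obtain ⟨z, hz, hzx, hzy⟩ := exists_regular_prod h2 h1
    have swap : ∀ w ∈ maximalIdeal R, IsSMulRegular M w → IsSMulRegular (QuotSMulTop w M) z →
        IsSMulRegular M z ∧ IsSMulRegular (QuotSMulTop z M) w := fun w hw hwr hzw => by
      have h3 : IsWeaklyRegular M [w, z] := by simp [hwr, hzw, IsWeaklyRegular.nil]
      have := isWeaklyRegular_of_perm_of_subset_maximalIdeal h3 (List.Perm.swap z w [])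
        (by simpa only [List.forall_mem_cons] using ⟨hw, hz, by simp⟩)
      simpa [IsWeaklyRegular.nil] using this
    have h4 : DepthGE R (QuotSMulTop z M) (n + 1) :=
      succ_iff.2 ⟨y, hy, (swap y hy hyr hzy).2, quot_comm (ih hd hz hzy)⟩
    exact succ_iff.2 ⟨z, hz, hzx, quot_comm (ih h4 hx (swap x hx hr hzx).2)⟩

/-- The depth lemma for the middle term of a short exact sequence. -/
theorem of_exact {P : Type*} [AddCommGroup P] [Module R P] [Module.Finite R P] {n : ℕ}
    {f : M →ₗ[R] P} {g : P →ₗ[R] N} (hf : Function.Injective f) (hfg : Function.Exact f g)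
    (hg : Function.Surjective g) (hM : DepthGE R M n) (hN : DepthGE R N n) : DepthGE R P n := by
  induction n generalizing M N P with
  | zero => exact zero
  | succ n ih =>
    obtain ⟨x, hx, hxM, hxN⟩ := exists_regular_prod (hM.mono (by omega)) (hN.mono (by omega))
    refine succ_iff.2 ⟨x, hx,
      isSMulRegular_of_range_eq_ker hf hfg.linearMap_ker_eq.symm hxM hxN, ?_⟩
    refine ih (f := QuotSMulTop.map x f) (g := QuotSMulTop.map x g) ?_
      (QuotSMulTop.map_exact x hfg hg) (QuotSMulTop.map_surjective x hg)
      (hM.quotSMulTop hx hxM) (hN.quotSMulTop hx hxN)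
    -- Reduction mod x keeps `f` injective because x is regular on N; the zero term on the left
    -- turns this into exactness at M.
    have h0 : Function.Exact (0 : PUnit →ₗ[R] M) f := by
      rw [LinearMap.exact_iff, LinearMap.range_zero, LinearMap.ker_eq_bot.2 hf]
    have := QuotSMulTop.map_first_exact_on_four_term_exact_of_isSMulRegular_last h0 hfg hxN
    rw [← LinearMap.ker_eq_bot, this.linearMap_ker_eq, map_zero, LinearMap.range_zero]

end Noetherian

end DepthGE

/-! ### Krull dimension and maximal Cohen–Macaulay modules -/

lemma exists_ringKrullDim_eq (R : Type*) [CommRing R] [IsLocalRing R] [IsNoetherianRing R] :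
    ∃ d : ℕ, ringKrullDim R = d := by
  obtain ⟨n, h⟩ := WithBot.ne_bot_iff_exists.1 (ringKrullDim_ne_bot (R := R))
  have h' := ringKrullDim_ne_top (R := R)
  rw [← h] at h'
  lift n to ℕ using fun h0 => h' (by rw [h0]; rfl)
  exact ⟨n, h.symm⟩

section Dimension

variable {R : Type*} [CommRing R] [IsLocalRing R] [IsNoetherianRing R] {d : ℕ}
  {M : Type*} [AddCommGroup M] [Module R M] [Module.Finite R M]

lemma RingTheory.Sequence.IsRegular.length_le_of_ringKrullDim_eq (hd : ringKrullDim R = d)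
    {rs : List R} (h : IsRegular M rs) : rs.length ≤ d := by
  have h1 := Module.supportDim_add_length_eq_supportDim_of_isRegular rs h
  have h2 := Module.supportDim_le_ringKrullDim R M
  have := h.quot_ofList_smul_nontrivial ⊤
  have h3 : 0 ≤ Module.supportDim R (M ⧸ (Ideal.ofList rs • ⊤ : Submodule R M)) := by
    obtain ⟨n, hn⟩ := WithBot.ne_bot_iff_exists.1 (Module.supportDim_ne_bot_of_nontrivial R
      (M ⧸ (Ideal.ofList rs • ⊤ : Submodule R M)))
    rw [← hn]
    exact WithBot.coe_le_coe.2 bot_le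
  rw [← h1, hd] at h2
  have h4 : (rs.length : WithBot ℕ∞) ≤ (d : WithBot ℕ∞) :=
    le_trans (by simpa using add_le_add_left h3 (rs.length : WithBot ℕ∞)) h2
  exact_mod_cast h4

lemma DepthGE.le_of_ringKrullDim_eq [Nontrivial M] (hd : ringKrullDim R = d) {n : ℕ}
    (h : DepthGE R M n) : n ≤ d := by
  obtain ⟨rs, rfl, hm, hr⟩ := h
  exact (IsRegular.of_isWeaklyRegular_of_mem_maximalIdeal M hm hr).length_le_of_ringKrullDim_eq hd

/-- Regular sequences never exceed the dimension, so only the lower bound on depth matters. Weak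
regularity absorbs the zero module, where d zeros will do. -/
lemma isMCM_iff_depthGE (hd : ringKrullDim R = d) : IsMCM R M ↔ DepthGE R M d := by
  rw [IsMCM, and_iff_right ‹_›]
  constructor
  · rintro (h | h)
    · refine ⟨List.replicate d 0, by simp, by simp +contextual [List.mem_replicate], ⟨?_⟩⟩
      intro i hi a b _
      exact Subsingleton.elim _ _
    · rw [hd] at h
      have h : localDepth R M = d := by exact_mod_cast h
      cases d with
      | zero => exact .zero
      | succ d =>
        by_contra hcon
        have : localDepth R M ≤ d := by
          refine iSup_le fun ⟨rs, hm, hr⟩ => ?_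
          by_contra! hlt
          exact hcon (DepthGE.mono (by exact_mod_cast hlt) ⟨rs, rfl, hm, hr.1⟩)
        rw [h] at this
        have : d + 1 ≤ d := by exact_mod_cast this
        omega
  · rintro ⟨rs, hl, hm, hr⟩
    rcases subsingleton_or_nontrivial M with h | h
    · exact .inl h
    · right
      rw [hd]
      have : localDepth R M = d := by
        apply le_antisymm
        · refine iSup_le fun ⟨rs, hm, hr⟩ => ?_
          exact_mod_cast hr.length_le_of_ringKrullDim_eq hd
        · rw [← hl]
          exact le_iSup (fun rs : {rs : List R // (∀ r ∈ rs, r ∈ maximalIdeal R) ∧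
            IsRegular M rs} => (rs.1.length : ℕ∞))
            ⟨rs, hm, IsRegular.of_isWeaklyRegular_of_mem_maximalIdeal M hm hr⟩
      rw [this]
      rfl

end Dimension

/-! ### Elements regular on the closed fibre of a flat module -/

section LocalFlatness

open TensorProduct

variable {R S : Type*} [CommRing R] [CommRing S] [Algebra R S]
  {T : Type*} [AddCommGroup T] [Module R T] [Module S T] [IsScalarTower R S T]
  {N : Type*} [AddCommGroup N] [Module R N]

lemma Module.Finite.tensorProduct_left [Module.Finite S T] [Module.Finite R N] :
    Module.Finite S (T ⊗[R] N) :=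
  .equiv (AlgebraTensorModule.cancelBaseChange R S S T N)

/-- Dividing the left factor of a tensor product by an element. -/
noncomputable def QuotSMulTop.tensorEquiv (y : S) (T : Type*) [AddCommGroup T] [Module R T]
    [Module S T] [IsScalarTower R S T] (N : Type*) [AddCommGroup N] [Module R N] :
    QuotSMulTop y (T ⊗[R] N) ≃ₗ[S] QuotSMulTop y T ⊗[R] N :=
  QuotSMulTop.equivQuotTensor y _ ≪≫ₗ
    (AlgebraTensorModule.assoc R S S (S ⧸ Ideal.span {y}) T N).symm ≪≫ₗ
    AlgebraTensorModule.congr (QuotSMulTop.equivQuotTensor y T).symm (.refl R N)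

lemma IsSMulRegular.tensorProduct_of_injective [Module.Flat R T] {N' : Type*} [AddCommGroup N']
    [Module R N'] (i : N' →ₗ[R] N) (hi : Function.Injective i) {y : S}
    (hy : IsSMulRegular (T ⊗[R] N) y) : IsSMulRegular (T ⊗[R] N') y :=
  hy.of_injective (AlgebraTensorModule.lTensor S T i)
    (Module.Flat.lTensor_preserves_injective_linearMap i hi)

lemma IsSMulRegular.tensorProduct_finsupp {y : S} (hy : IsSMulRegular (T ⊗[R] N) y) (ι : Type*) :
    IsSMulRegular (T ⊗[R] (ι →₀ N)) y := by
  classical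
  rw [(TensorProduct.finsuppRight R S T N ι).isSMulRegular_congr]
  intro f g h
  ext i
  exact hy (DFunLike.congr_fun h i)

/-- N/IN is a vector space over R/I, hence a direct sum of copies of R/I. -/
lemma IsSMulRegular.tensorProduct_quotient_smul_top {I : Ideal R} [hI : I.IsMaximal] {y : S}
    (hy : IsSMulRegular (T ⊗[R] (R ⧸ I)) y) (N : Type*) [AddCommGroup N] [Module R N] :
    IsSMulRegular (T ⊗[R] (N ⧸ (I • ⊤ : Submodule R N))) y := by
  let := Ideal.Quotient.field I
  let b := Module.Basis.ofVectorSpace (R ⧸ I) (N ⧸ (I • ⊤ : Submodule R N))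
  have := hy.tensorProduct_finsupp (Module.Basis.ofVectorSpaceIndex (R ⧸ I)
    (N ⧸ (I • ⊤ : Submodule R N)))
  rwa [(AlgebraTensorModule.congr (.refl S T) (b.repr.restrictScalars R)).isSMulRegular_congr]

/-- Since y is regular on T ⊗ N/IN, z comes from T ⊗ IN; by flatness its lift is again killed by y,
so the argument repeats with IN. Krull's intersection theorem will then give z = 0. -/
lemma mem_pow_smul_top_of_smul_eq_zero [Module.Flat R T] {I : Ideal R} [I.IsMaximal] {y : S}
    (hy : IsSMulRegular (T ⊗[R] (R ⧸ I)) y) (j : ℕ) {N : Type*} [AddCommGroup N] [Module R N]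
    (z : T ⊗[R] N) (hz : y • z = 0) :
    z ∈ ((I.map (algebraMap R S)) ^ j • ⊤ : Submodule S (T ⊗[R] N)) := by
  induction j generalizing N with
  | zero => simp
  | succ j ih =>
    have h0 : AlgebraTensorModule.lTensor S T (I • ⊤ : Submodule R N).mkQ z = 0 := by
      apply (hy.tensorProduct_quotient_smul_top N).right_eq_zero_of_smul
      rw [← map_smul, hz, map_zero]
    obtain ⟨w, hw⟩ := (lTensor_exact T (f := (I • ⊤ : Submodule R N).subtype)
      (LinearMap.exact_subtype_mkQ _) (Submodule.mkQ_surjective _) z).1 h0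
    let F := AlgebraTensorModule.lTensor S T (I • ⊤ : Submodule R N).subtype
    have hF : Function.Injective F :=
      Module.Flat.lTensor_preserves_injective_linearMap _ (Submodule.injective_subtype _)
    have hwz : F w = z := hw
    have hw0 : y • w = 0 := hF (by rw [map_smul, hwz, hz, map_zero])
    have hrange : F.range ≤ I.map (algebraMap R S) • ⊤ := by
      rintro _ ⟨u, rfl⟩
      induction u with
      | zero => simp
      | add a b ha hb => rw [map_add]; exact add_mem ha hb
      | tmul t n =>
        obtain ⟨n, hn⟩ := n
        change t ⊗ₜ n ∈ _
        refine Submodule.smul_induction_on hn (fun r hr n _ => ?_) (fun a b ha hb => ?_)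
        · rw [tmul_smul, ← algebraMap_smul S r]
          exact Submodule.smul_mem_smul (Ideal.mem_map_of_mem _ hr) trivial
        · rw [tmul_add]; exact add_mem ha hb
    rw [← hwz, pow_succ, Submodule.mul_smul]
    refine smul_mono_right _ hrange ?_
    rw [LinearMap.range_eq_map, ← Submodule.map_smul'']
    exact Submodule.mem_map_of_mem (ih w hw0)

lemma QuotSMulTop.exact_lsmul_mkQ (y : S) (T : Type*) [AddCommGroup T] [Module S T] :
    Function.Exact (LinearMap.lsmul S T y) (Submodule.mkQ (y • (⊤ : Submodule S T))) := by
  intro t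
  rw [Submodule.mkQ_apply, Submodule.Quotient.mk_eq_zero,
    Submodule.mem_smul_pointwise_iff_exists]
  simp

lemma rTensor_lsmul_restrictScalars (y : S) (u : T ⊗[R] N) :
    ((LinearMap.lsmul S T y).restrictScalars R).rTensor N u = y • u := by
  induction u with
  | zero => simp
  | add a b ha hb => rw [map_add, ha, hb, smul_add]
  | tmul t p => rfl

variable [IsLocalRing R] [IsLocalRing S] [IsNoetherianRing S] [IsLocalHom (algebraMap R S)]
  [Module.Finite S T] [Module.Flat R T]

/-- An element that is regular on the closed fibre of a flat module is regular on every
base change. -/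
theorem IsSMulRegular.tensorProduct_of_residue {y : S}
    (hy : IsSMulRegular (T ⊗[R] (R ⧸ maximalIdeal R)) y)
    (N : Type*) [AddCommGroup N] [Module R N] [Module.Finite R N] :
    IsSMulRegular (T ⊗[R] N) y := by
  refine IsSMulRegular.of_right_eq_zero_of_smul fun z hz => ?_
  have := Module.Finite.tensorProduct_left (R := R) (S := S) (T := T) (N := N)
  have hle : (maximalIdeal R).map (algebraMap R S) ≤ maximalIdeal S :=
    ((local_hom_TFAE (algebraMap R S)).out 0 2 rfl rfl).1 ‹_›
  have := Ideal.iInf_pow_smul_eq_bot_of_isLocalRing (M := T ⊗[R] N)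
    ((maximalIdeal R).map (algebraMap R S)) 
    (ne_top_of_le_ne_top (maximalIdeal.isMaximal S).ne_top hle)
  rw [← Submodule.mem_bot S, ← this, Submodule.mem_iInf]
  exact fun j => mem_pow_smul_top_of_smul_eq_zero hy j z hz

/-- The cokernel of an element regular on the closed fibre of a flat module is flat. -/
theorem Module.Flat.of_exact_lsmul {Q : Type*} [AddCommGroup Q] [Module R Q] {y : S}
    (hy : IsSMulRegular (T ⊗[R] (R ⧸ maximalIdeal R)) y) {q : T →ₗ[R] Q}
    (hex : Function.Exact ((LinearMap.lsmul S T y).restrictScalars R) q)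
    (hq : Function.Surjective q) : Module.Flat R Q := by
  rw [Module.Flat.iff_lTensor_injective]
  intro I _
  rw [injective_iff_map_eq_zero]
  intro z hz
  obtain ⟨a, rfl⟩ := LinearMap.rTensor_surjective I hq z
  rw [← LinearMap.comp_apply, LinearMap.lTensor_comp_rTensor, ← LinearMap.rTensor_comp_lTensor,
    LinearMap.comp_apply] at hz
  obtain ⟨c, hc⟩ := (_root_.rTensor_exact R hex hq _).1 hz
  rw [rTensor_lsmul_restrictScalars] at hc
  have hI := _root_.lTensor_exact T (LinearMap.exact_subtype_mkQ I) (Submodule.mkQ_surjective _)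
  -- As y • c comes from T ⊗ I and y is regular on T ⊗ R/I, c itself lifts to T ⊗ I; so a is a
  -- multiple of y and dies in Q ⊗ I.
  have hc0 : AlgebraTensorModule.lTensor S T (Submodule.mkQ I) c = 0 := by
    apply (hy.tensorProduct_of_residue (R ⧸ I)).right_eq_zero_of_smul
    rw [← map_smul, hc]
    exact (hI _).2 ⟨a, rfl⟩
  obtain ⟨c', rfl⟩ := (hI c).1 hc0
  have hinj := Module.Flat.lTensor_preserves_injective_linearMap (M := T) I.subtype
    (Submodule.injective_subtype _)
  have : y • c' = a := hinj (by
    rw [← hc]; exact map_smul (AlgebraTensorModule.lTensor S T I.subtype) y c')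
  rw [← this, ← rTensor_lsmul_restrictScalars]
  exact ((_root_.rTensor_exact I hex hq) _).2 ⟨c', rfl⟩

/-- Dividing a flat module by an element regular on its closed fibre keeps it flat. -/
theorem Module.Flat.quotSMulTop {y : S}
    (hy : IsSMulRegular (T ⊗[R] (R ⧸ maximalIdeal R)) y) : Module.Flat R (QuotSMulTop y T) := by
  let q : T →ₗ[R] QuotSMulTop y T :=
    LinearMap.restrictScalars R (Submodule.mkQ (y • (⊤ : Submodule S T)))
  have hq : Function.Surjective q := Submodule.mkQ_surjective (y • (⊤ : Submodule S T))
  have hex : Function.Exact ((LinearMap.lsmul S T y).restrictScalars R) q :=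
    QuotSMulTop.exact_lsmul_mkQ y T
  exact Module.Flat.of_exact_lsmul hy hex hq

/-- If `K` has nonzero socle, a depth bound on the base change of `K` holds for the base change
of every finite module. -/
theorem DepthGE.tensorProduct_of_socle {n : ℕ} {K : Type*} [AddCommGroup K] [Module R K] {v : K}
    (hv : v ≠ 0) (hm : ∀ r ∈ maximalIdeal R, r • v = 0) (h : DepthGE S (T ⊗[R] K) n)
    (N : Type*) [AddCommGroup N] [Module R N] [Module.Finite R N] : DepthGE S (T ⊗[R] N) n := by
  induction n generalizing T with
  | zero => exact zero
  | succ n ih =>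
    obtain ⟨y, hyS, hy, hd⟩ := succ_iff.1 h
    have hker : maximalIdeal R = (LinearMap.toSpanSingleton R K v).ker := by
      refine (maximalIdeal.isMaximal R).eq_of_le (fun ht => hv ?_) hm
      have : (1 : R) ∈ (LinearMap.toSpanSingleton R K v).ker := ht ▸ trivial
      simpa using this
    -- The line spanned by v is a copy of the residue field, and T ⊗ k embeds in T ⊗ K by flatness.
    let i := (maximalIdeal R).liftQ (LinearMap.toSpanSingleton R K v) hker.le
    have hi : Function.Injective i := LinearMap.ker_eq_bot.1 <|
      Submodule.ker_liftQ_eq_bot _ _ _ hker.ge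
    have hy' := hy.tensorProduct_of_injective i hi
    have := Module.Flat.quotSMulTop hy'
    exact succ_iff.2 ⟨y, hyS, hy'.tensorProduct_of_residue N,
      (ih (hd.congr (QuotSMulTop.tensorEquiv y T K))).congr (QuotSMulTop.tensorEquiv y T N).symm⟩

end LocalFlatness

/-! ### Ascent and descent of maximal depth -/

section BaseChange

open TensorProduct

variable {R S : Type*} [CommRing R] [CommRing S] [Algebra R S] [IsLocalRing R] [IsLocalRing S]
  [IsNoetherianRing R] [IsNoetherianRing S] [IsLocalHom (algebraMap R S)] [Module.Flat R S]
  {C : Type*} [AddCommGroup C] [Module R C] [Module.Finite R C]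

omit [IsNoetherianRing R] [IsNoetherianRing S] [Module.Flat R S] in
lemma IsLocalRing.algebraMap_mem_maximalIdeal {x : R} (hx : x ∈ maximalIdeal R) :
    algebraMap R S x ∈ maximalIdeal S := by
  simpa using hx

-- By flatness a C-regular sequence stays regular on S ⊗ C. The bound `e` is asked of all N because
-- the induction replaces C by its quotients.
universe v in
omit [IsNoetherianRing R] [IsNoetherianRing S] in
lemma DepthGE.baseChange_add {e t : ℕ} {C : Type v} [AddCommGroup C] [Module R C]
    [Module.Finite R C] (he : ∀ (N : Type v) [AddCommGroup N] [Module R N] [Module.Finite R N],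
      DepthGE S (S ⊗[R] N) e) (h : DepthGE R C t) : DepthGE S (S ⊗[R] C) (t + e) := by
  induction t generalizing C with
  | zero => simpa using he C
  | succ t ih =>
    obtain ⟨x, hx, hr, hd⟩ := succ_iff.1 h
    rw [add_right_comm]
    exact succ_iff.2 ⟨algebraMap R S x, algebraMap_mem_maximalIdeal hx,
      hr.of_flat_of_isBaseChange (TensorProduct.isBaseChange R C S),
      (ih hd).congr (QuotSMulTop.algebraMapTensorEquivTensorQuotSMulTop x C S).symm⟩

-- Here t is the exact depth of C, and K is C modulo a regular sequence of length t. Each division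
-- costs S ⊗ C at most one unit of depth.
universe v in
lemma DepthGE.exists_socle_of_baseChange {t n : ℕ} {C : Type v} [AddCommGroup C] [Module R C]
    [Module.Finite R C] (h : DepthGE R C t) (h' : ¬ DepthGE R C (t + 1))
    (hS : DepthGE S (S ⊗[R] C) (t + n)) :
    ∃ (K : Type v) (_ : AddCommGroup K) (_ : Module R K) (v : K), v ≠ 0 ∧
      (∀ r ∈ maximalIdeal R, r • v = 0) ∧ DepthGE S (S ⊗[R] K) n := by
  induction t generalizing C with
  | zero =>
    rw [zero_add, one_iff_socle] at h'
    push Not at h'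
    obtain ⟨v, hv, hv0⟩ := h'
    exact ⟨C, _, _, v, hv0, hv, by simpa using hS⟩
  | succ t ih =>
    obtain ⟨x, hx, hr, hd⟩ := succ_iff.1 h
    refine ih hd (fun hcon => h' (succ_iff.2 ⟨x, hx, hr, hcon⟩)) ?_
    rw [add_right_comm] at hS
    exact (hS.quotSMulTop (algebraMap_mem_maximalIdeal hx)
      (hr.of_flat_of_isBaseChange (TensorProduct.isBaseChange R C S))).congr
      (QuotSMulTop.algebraMapTensorEquivTensorQuotSMulTop x C S)

/-- Along a flat local homomorphism of Cohen-Macaulay rings, having maximal depth ascends and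
descends. -/
theorem DepthGE.baseChange_iff {d D : ℕ} (hR : DepthGE R R d) (hR' : ¬ DepthGE R R (d + 1))
    (hS : DepthGE S S D) (hS' : ¬ DepthGE S S (D + 1)) :
    DepthGE S (S ⊗[R] C) D ↔ DepthGE R C d := by
  have e := AlgebraTensorModule.rid R S S
  have hdD : d ≤ D := by
    by_contra! hlt
    exact hS' (((hR.baseChange_add (S := S) (e := 0) fun _ _ _ _ => zero).congr e).mono (by omega))
  constructor
  · intro hC
    by_contra hcon
    classical
    have hex : ∃ t, ¬ DepthGE R C (t + 1) := ⟨d, fun h => hcon (h.mono (by omega))⟩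
    let t := Nat.find hex
    have ht : ¬ DepthGE R C (t + 1) := Nat.find_spec hex
    have ht' : DepthGE R C t := by
      rcases Nat.eq_zero_or_pos t with h0 | h0
      · rw [h0]; exact zero
      · have := Nat.find_min hex (m := t - 1) (by omega)
        rwa [not_not, Nat.sub_add_cancel h0] at this
    have htd : t < d := by
      by_contra! hle
      exact hcon (ht'.mono hle)
    -- If t = depth C < d, every base change has depth at least D - t, so S would have depth at
    -- least d + (D - t) > D.
    obtain ⟨K, _, _, v, hv, hm, hK⟩ := ht'.exists_socle_of_baseChange (S := S) (n := D - t) ht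
      (hC.mono (by omega))
    refine hS' (((hR.baseChange_add (S := S) (e := D - t) fun N _ _ _ => ?_).congr e).mono (by omega))
    exact hK.tensorProduct_of_socle hv hm N
  · intro hC
    -- Now K is a quotient of R itself, giving D - d for all base changes; C adds d.
    obtain ⟨K, _, _, v, hv, hm, hK⟩ := hR.exists_socle_of_baseChange (S := S) (n := D - d) hR'
      ((hS.congr e.symm).mono (by omega))
    exact (hC.baseChange_add (S := S) (e := D - d) fun N _ _ _ => hK.tensorProduct_of_socle hv hm N).mono
      (by omega)

end BaseChange
open TensorProduct

/-! ### Free summands and functionals under base change -/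

section FreeSummand

variable {R : Type*} [CommRing R] [IsLocalRing R] {M : Type*} [AddCommGroup M] [Module R M]

/-- A coordinate on the summand takes the value 1; conversely φ v = 1 splits M as Rv ⊕ ker φ. -/
lemma hasNonzeroFreeSummand_iff :
    HasNonzeroFreeSummand R M ↔ ∃ (φ : M →ₗ[R] R) (m : M), IsUnit (φ m) := by
  constructor
  · rintro ⟨P, Q, hPQ, hP, hfree⟩
    have : Nontrivial P := (Submodule.nontrivial_iff_ne_bot).2 hP
    let b := Module.Free.chooseBasis R P
    obtain ⟨i⟩ := b.index_nonempty
    refine ⟨b.coord i ∘ₗ P.projectionOnto Q hPQ, b i, ?_⟩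
    rw [LinearMap.comp_apply, Submodule.projectionOnto_apply_left]
    simp
  · rintro ⟨φ, m, u, hu⟩
    have h1 : φ ((↑u⁻¹ : R) • m) = 1 := by rw [map_smul, ← hu, smul_eq_mul, Units.inv_mul]
    set v := (↑u⁻¹ : R) • m
    let i := LinearMap.toSpanSingleton R M v
    have hφi : φ ∘ₗ i = LinearMap.id := by ext; simp [i, h1]
    have hφ : ∀ r, φ (i r) = r := LinearMap.congr_fun hφi
    have hi : Function.Injective i := Function.LeftInverse.injective hφ
    refine ⟨i.range, φ.ker, ⟨?_, ?_⟩, ?_, .of_equiv (LinearEquiv.ofInjective i hi)⟩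
    · rw [Submodule.disjoint_def]
      rintro _ ⟨r, rfl⟩ hr
      rw [LinearMap.mem_ker, hφ] at hr
      rw [hr, map_zero]
    · rw [codisjoint_iff, eq_top_iff]
      intro x _
      rw [Submodule.mem_sup]
      exact ⟨i (φ x), ⟨_, rfl⟩, x - i (φ x), by simp [hφ], by abel⟩
    · rw [ne_eq, LinearMap.range_eq_bot]
      intro h0
      have := hφ 1
      simp [h0] at this

end FreeSummand

section Hom

variable {R S M : Type*} [CommRing R] [CommRing S] [Algebra R S] [AddCommGroup M] [Module R M]
  [Module.Flat R S] [Module.FinitePresentation R M]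

/-- Every functional on a base change is a combination of base changed functionals. -/
lemma baseChange_dual_induction {motive : (S ⊗[R] M →ₗ[S] S ⊗[R] R) → Prop}
    (zero : motive 0) (add : ∀ a b, motive a → motive b → motive (a + b))
    (smul : ∀ (s : S) (φ : M →ₗ[R] R), motive (s • φ.baseChange S)) (ψ) : motive ψ := by
  obtain ⟨u, rfl⟩ := (Module.FinitePresentation.isBaseChange_map R M R S).equiv.surjective ψ
  induction u with
  | zero => simpa using zero
  | add a b ha hb => rw [map_add]; exact add _ _ ha hb
  | tmul s φ => rw [IsBaseChange.equiv_tmul]; exact smul s φ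

/-- If all functionals on M have values in the maximal ideal of R, then their S-combinations have
values in that of S. -/
lemma hasNonzeroFreeSummand_baseChange_iff [IsLocalRing R] [IsLocalRing S]
    [IsLocalHom (algebraMap R S)] :
    HasNonzeroFreeSummand S (S ⊗[R] M) ↔ HasNonzeroFreeSummand R M := by
  rw [hasNonzeroFreeSummand_iff, hasNonzeroFreeSummand_iff]
  let e := AlgebraTensorModule.rid R S S
  constructor
  · rintro ⟨ψ, z, hz⟩
    by_contra! hcon
    have key : ∀ ψ : S ⊗[R] M →ₗ[S] S ⊗[R] R, ∀ z, e (ψ z) ∈ maximalIdeal S := by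
      intro ψ
      induction ψ using baseChange_dual_induction with
      | zero => simp
      | add a b ha hb => intro z; rw [LinearMap.add_apply, map_add]; exact add_mem (ha z) (hb z)
      | smul s φ =>
        intro z
        induction z with
        | zero => simp
        | add a b ha hb => rw [map_add, map_add]; exact add_mem ha hb
        | tmul t m =>
          have : φ m ∈ maximalIdeal R := (mem_maximalIdeal _).2 (hcon φ m)
          have h2 : e ((s • φ.baseChange S) (t ⊗ₜ m)) = s * t * algebraMap R S (φ m) := by
            simp [e, Algebra.smul_def]; ring
          rw [h2]
          exact Ideal.mul_mem_left _ _ (algebraMap_mem_maximalIdeal this)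
    have := key (e.symm.toLinearMap ∘ₗ ψ) z
    rw [LinearMap.comp_apply, LinearEquiv.coe_coe, e.apply_symm_apply] at this
    exact (mem_maximalIdeal _).1 this hz
  · rintro ⟨φ, m, hm⟩
    refine ⟨e.toLinearMap ∘ₗ φ.baseChange S, 1 ⊗ₜ m, ?_⟩
    have : (e.toLinearMap ∘ₗ φ.baseChange S) (1 ⊗ₜ m) = algebraMap R S (φ m) := by
      simp [e, Algebra.smul_def]
    rw [this]
    exact hm.map _

end Hom

/-! ### Left approximations by free modules -/

section Approximation

variable {R : Type*} [CommRing R] {M : Type*} [AddCommGroup M] [Module R M]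

/-- A left approximation of `M` by free modules: every functional factors through `f`. -/
def IsLeftFreeApprox {F : Type*} [AddCommGroup F] [Module R F] (f : M →ₗ[R] F) : Prop :=
  ∀ φ : M →ₗ[R] R, ∃ g : F →ₗ[R] R, φ = g ∘ₗ f

lemma IsLeftFreeApprox.exists_comp_eq {F : Type*} [AddCommGroup F] [Module R F] {f : M →ₗ[R] F}
    (hf : IsLeftFreeApprox f) {ι : Type*} (i : M →ₗ[R] (ι → R)) :
    ∃ g : F →ₗ[R] (ι → R), i = g ∘ₗ f := by
  choose g hg using fun j => hf (LinearMap.proj j ∘ₗ i)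
  exact ⟨LinearMap.pi g, LinearMap.ext fun m => funext fun j => LinearMap.congr_fun (hg j) m⟩

lemma exists_isLeftFreeApprox [IsNoetherianRing R] [Module.Finite R M] :
    ∃ (n : ℕ) (f : M →ₗ[R] (Fin n → R)), IsLeftFreeApprox f := by
  have : Module.Finite R (M →ₗ[R] R) := by
    obtain ⟨n, p, hp⟩ := Module.Finite.exists_fin' R M
    exact .of_injective (p.lcomp R R) (LinearMap.lcomp_injective_of_surjective p hp)
  obtain ⟨n, s, hs⟩ := Module.Finite.exists_fin (R := R) (M := M →ₗ[R] R)
  refine ⟨n, LinearMap.pi s, fun φ => ?_⟩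
  have hφ : φ ∈ Submodule.span R (Set.range s) := hs ▸ trivial
  obtain ⟨c, rfl⟩ := (Submodule.mem_span_range_iff_exists_fun R).1 hφ
  refine ⟨∑ j, c j • LinearMap.proj j, ?_⟩
  ext m
  simp

/-- The base change of a map into a finite free module. -/
noncomputable def LinearMap.baseChangePi (S : Type*) [CommRing S] [Algebra R S] {n : ℕ}
    (f : M →ₗ[R] (Fin n → R)) : S ⊗[R] M →ₗ[S] (Fin n → S) :=
  (TensorProduct.piScalarRight R S S (Fin n)).toLinearMap ∘ₗ f.baseChange S

variable {S : Type*} [CommRing S] [Algebra R S] {n : ℕ} {f : M →ₗ[R] (Fin n → R)}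

/-- Factoring through `f` is preserved by S-linear combinations, and base changed functionals span
the dual. -/
lemma IsLeftFreeApprox.baseChangePi [Module.Flat R S] [Module.FinitePresentation R M]
    (hf : IsLeftFreeApprox f) : IsLeftFreeApprox (f.baseChangePi S) := by
  have key : ∀ ψ : S ⊗[R] M →ₗ[S] S ⊗[R] R,
      ∃ G : S ⊗[R] (Fin n → R) →ₗ[S] S ⊗[R] R, ψ = G ∘ₗ f.baseChange S := by
    intro ψ
    induction ψ using baseChange_dual_induction with
    | zero => exact ⟨0, by simp⟩
    | add a b ha hb =>
      obtain ⟨G, rfl⟩ := ha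
      obtain ⟨H, rfl⟩ := hb
      exact ⟨G + H, by rw [LinearMap.add_comp]⟩
    | smul s φ =>
      obtain ⟨g, rfl⟩ := hf φ
      exact ⟨s • g.baseChange S, by rw [LinearMap.baseChange_comp, LinearMap.smul_comp]⟩
  intro φ
  let e := AlgebraTensorModule.rid R S S
  obtain ⟨G, hG⟩ := key (e.symm.toLinearMap ∘ₗ φ)
  refine ⟨e.toLinearMap ∘ₗ G ∘ₗ (TensorProduct.piScalarRight R S S (Fin n)).symm.toLinearMap, ?_⟩
  refine LinearMap.ext fun z => ?_
  have := LinearMap.congr_fun hG z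
  simp only [LinearMap.comp_apply, LinearEquiv.coe_coe, LinearMap.baseChangePi,
    LinearEquiv.symm_apply_apply] at this ⊢
  rw [← this, LinearEquiv.apply_symm_apply]

lemma LinearMap.baseChangePi_injective_iff [Module.FaithfullyFlat R S] :
    Function.Injective (f.baseChangePi S) ↔ Function.Injective f := by
  rw [← Module.FaithfullyFlat.lTensor_injective_iff_injective R S f]
  exact (TensorProduct.piScalarRight R S S (Fin n)).injective.of_comp_iff _

/-- Cokernels commute with base change. -/
noncomputable def LinearMap.cokerBaseChangePi (S : Type*) [CommRing S] [Algebra R S]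
    (f : M →ₗ[R] (Fin n → R)) :
    (S ⊗[R] ((Fin n → R) ⧸ f.range)) ≃ₗ[S] ((Fin n → S) ⧸ (f.baseChangePi S).range) :=
  let e := TensorProduct.piScalarRight R S S (Fin n)
  let g : (Fin n → S) →ₗ[S] S ⊗[R] ((Fin n → R) ⧸ f.range) :=
    f.range.mkQ.baseChange S ∘ₗ e.symm.toLinearMap
  have hg : Function.Surjective g :=
    (LinearMap.lTensor_surjective S f.range.mkQ_surjective).comp e.symm.surjective
  have hker : g.ker = (f.baseChangePi S).range := by
    ext z
    have := lTensor_exact S (LinearMap.exact_map_mkQ_range f) f.range.mkQ_surjective (e.symm z)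
    refine this.trans ⟨?_, ?_⟩
    · rintro ⟨w, hw⟩
      exact ⟨w, e.symm.injective ((e.symm_apply_apply _).trans hw)⟩
    · rintro ⟨w, rfl⟩
      exact ⟨w, (e.symm_apply_apply _).symm⟩
  (g.quotKerEquivOfSurjective hg).symm ≪≫ₗ Submodule.quotEquivOfEq _ _ hker

end Approximation

/-! ### The syzygy criterion -/

section CohenMacaulay

lemma IsMCM.congr {R M N : Type*} [CommRing R] [IsLocalRing R] [IsNoetherianRing R]
    [AddCommGroup M] [Module R M] [AddCommGroup N] [Module R N] (e : M ≃ₗ[R] N)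
    (h : IsMCM R M) : IsMCM R N := by
  obtain ⟨d, hd⟩ := exists_ringKrullDim_eq R
  have := h.1
  have := Module.Finite.equiv e
  exact (isMCM_iff_depthGE hd).2 (((isMCM_iff_depthGE hd).1 h).congr e)

lemma IsCMLocalRing.depthGE {R : Type*} [CommRing R] [IsCMLocalRing R] {d : ℕ}
    (hd : ringKrullDim R = d) : DepthGE R R d :=
  (isMCM_iff_depthGE hd).1 ⟨inferInstance, .inr IsCMLocalRing.depth_eq_dim⟩

theorem isMCM_baseChange_iff {R S C : Type*} [CommRing R] [IsCMLocalRing R] [CommRing S]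
    [IsCMLocalRing S] [Algebra R S] [Module.FaithfullyFlat R S] [AddCommGroup C] [Module R C]
    [Module.Finite R C] : IsMCM S (S ⊗[R] C) ↔ IsMCM R C := by
  obtain ⟨d, hd⟩ := exists_ringKrullDim_eq R
  obtain ⟨D, hD⟩ := exists_ringKrullDim_eq S
  rw [isMCM_iff_depthGE hd, isMCM_iff_depthGE hD]
  exact DepthGE.baseChange_iff (IsCMLocalRing.depthGE hd)
    (fun h => by have := h.le_of_ringKrullDim_eq hd; omega) (IsCMLocalRing.depthGE hD)
    (fun h => by have := h.le_of_ringKrullDim_eq hD; omega)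

/-- A maximal Cohen-Macaulay module is a syzygy of one iff a left free approximation is injective
with maximal Cohen-Macaulay cokernel. -/
theorem isSyzygyOfMCM_iff {R M : Type*} [CommRing R] [IsCMLocalRing R] [AddCommGroup M]
    [Module R M] (hM : IsMCM R M) {n : ℕ} {f : M →ₗ[R] (Fin n → R)} (hf : IsLeftFreeApprox f) :
    IsSyzygyOfMCM R M ↔ Function.Injective f ∧ IsMCM R ((Fin n → R) ⧸ f.range) := by
  constructor
  · rintro ⟨-, k, N, _, _, p, hN, hp, ⟨e⟩⟩
    let i : M →ₗ[R] (Fin k → R) := p.ker.subtype ∘ₗ e.toLinearMap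
    have hi : Function.Injective i := Subtype.val_injective.comp e.injective
    have hip : Function.Exact i p := by
      intro x
      constructor
      · intro hx
        exact ⟨e.symm ⟨x, hx⟩, by simp [i]⟩
      · rintro ⟨m, rfl⟩
        exact (e m).2
    obtain ⟨g, hg⟩ := hf.exists_comp_eq i
    have hgf : ∀ m, i m = g (f m) := LinearMap.congr_fun hg
    refine ⟨Function.Injective.of_comp (f := g) (by
      rw [← LinearMap.coe_comp, ← hg]; exact hi), ?_⟩
    let h : ((Fin n → R) ⧸ f.range) →ₗ[R] N := f.range.liftQ (p ∘ₗ g) (by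
      rintro _ ⟨m, rfl⟩
      rw [LinearMap.mem_ker, LinearMap.comp_apply, ← hgf]
      exact (hip _).2 ⟨m, rfl⟩)
    have hh : ∀ v, h (f.range.mkQ v) = p (g v) := fun v => rfl
    -- The pushout of `f` and `i`, written as an exact sequence 0 → Rⁿ → coker f ⊕ Rᵏ → N → 0; it
    -- splits off Rᵏ because `i` factors through `f`.
    let α : (Fin n → R) →ₗ[R] ((Fin n → R) ⧸ f.range) × (Fin k → R) := f.range.mkQ.prod g
    let β : ((Fin n → R) ⧸ f.range) × (Fin k → R) →ₗ[R] N := (-h).coprod p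
    have hα : Function.Injective α := by
      rw [injective_iff_map_eq_zero]
      intro v hv
      have h1 : f.range.mkQ v = 0 := congrArg Prod.fst hv
      have h2 : g v = 0 := congrArg Prod.snd hv
      rw [Submodule.mkQ_apply, Submodule.Quotient.mk_eq_zero] at h1
      obtain ⟨m, rfl⟩ := h1
      rw [← hgf] at h2
      rw [hi (h2.trans (map_zero i).symm), map_zero]
    have hαβ : Function.Exact α β := by
      rintro ⟨c, w⟩
      obtain ⟨v, rfl⟩ := f.range.mkQ_surjective c
      have hβ : β (f.range.mkQ v, w) = p (w - g v) := by
        simp only [β, LinearMap.coprod_apply, LinearMap.neg_apply, hh, map_sub]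
        abel
      rw [hβ]
      constructor
      · intro h0
        obtain ⟨m, hm⟩ := (hip _).1 h0
        refine ⟨v + f m, Prod.ext ?_ ?_⟩
        · change f.range.mkQ (v + f m) = f.range.mkQ v
          rw [map_add, add_eq_left, Submodule.mkQ_apply, Submodule.Quotient.mk_eq_zero]
          exact ⟨m, rfl⟩
        · change g (v + f m) = w
          rw [map_add, ← hgf, hm]; abel
      · rintro ⟨v', hv'⟩
        have h1 : f.range.mkQ v' = f.range.mkQ v := congrArg Prod.fst hv'
        have h2 : g v' = w := congrArg Prod.snd hv'
        rw [← h2, map_sub, ← hh, ← hh, h1, sub_self]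
    have hβ : Function.Surjective β := fun x => by
      obtain ⟨w, rfl⟩ := hp x
      exact ⟨(0, w), by simp [β]⟩
    obtain ⟨d, hd⟩ := exists_ringKrullDim_eq R
    have := hN.1
    have hfree : DepthGE R (Fin n → R) d := by
      have hR := IsCMLocalRing.depthGE hd
      clear * - hR
      induction n with
      | zero => exact .of_retract (0 : (Fin 0 → R) →ₗ[R] R) 0 (Subsingleton.elim _ _) hR
      | succ n ih =>
        have h1 : DepthGE R (R × (Fin n → R)) d :=
          .of_exact (LinearMap.inl_injective (R := R)) .inl_snd (LinearMap.snd_surjective) hR ih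
        exact h1.congr (Fin.consLinearEquiv R fun _ => R)
    have hprod := DepthGE.of_exact hα hαβ hβ hfree ((isMCM_iff_depthGE hd).1 hN)
    exact (isMCM_iff_depthGE hd).2 (hprod.of_retract (LinearMap.inl R _ _) (LinearMap.fst R _ _)
      (LinearMap.fst_comp_inl R _ _))
  · rintro ⟨hinj, hC⟩
    exact ⟨hM, n, _, _, _, f.range.mkQ, hC, f.range.mkQ_surjective,
      ⟨LinearEquiv.ofInjective f hinj ≪≫ₗ LinearEquiv.ofEq _ _ f.range.ker_mkQ.symm⟩⟩

end CohenMacaulay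

theorem corollary3p4 {R S M : Type*} [CommRing R] [IsCMLocalRing R] [CommRing S] [IsCMLocalRing S]
    [Algebra R S] [Module.FaithfullyFlat R S] [AddCommGroup M] [Module R M] (hM : IsMCM R M) :
    IsOCMS R M ↔ IsOCMS S (TensorProduct R S M) := by
  have := hM.1
  have := Module.finitePresentation_of_finite R M
  obtain ⟨n, f, hf⟩ := exists_isLeftFreeApprox (R := R) (M := M)
  have hcoker : IsMCM S ((Fin n → S) ⧸ (f.baseChangePi S).range) ↔
      IsMCM R ((Fin n → R) ⧸ f.range) := by
    rw [← isMCM_baseChange_iff (R := R) (S := S)]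
    exact ⟨IsMCM.congr (f.cokerBaseChangePi S).symm, IsMCM.congr (f.cokerBaseChangePi S)⟩
  rw [IsOCMS, IsOCMS, isSyzygyOfMCM_iff hM hf,
    isSyzygyOfMCM_iff (isMCM_baseChange_iff.2 hM) hf.baseChangePi,
    LinearMap.baseChangePi_injective_iff, hcoker, hasNonzeroFreeSummand_baseChange_iff]
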